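/- Let $X_1,X_2,\dots$ be i.i.d. real random variables with law $P_T$ and distribution function $\mathbb{F}_T$, and let $\mathbb{F}_n(y)=\frac1n\sum_{i=1}^n \mathbf 1\{X_i\le y\}$. Let $\Theta\subset\mathbb{R}^d$, $\mathcal A\subset\mathbb{R}^s$, let $(P_1(\cdot|\theta))_{\theta\in\Theta}$ be a family of probability measures on $\mathbb{R}$ with distribution functions $\mathbb{F}_1(\cdot|\theta)$, and let $\Phi\subset(0,1)\times\Theta\times\mathcal A$. For $\phi=(\lambda,\theta,\alpha)\in\Phi$ put $$\mathbb{F}_0(y|\phi)=\tfrac{1}{1-\lambda}\mathbb{F}_T(y)-\tfrac{\lambda}{1-\lambda}\mathbb{F}_1(y|\theta),\qquad \hat{\mathbb{F}}_0(y|\phi)=\tfrac{1}{1-\lambda}\mathbb{F}_n(y)-\tfrac{\lambda}{1-\lambda}\mathbb{F}_1(y|\theta).$$ For $r\ge 2$ let $c_{r,k}=(-1)^{r-1-k}\binom{r-1}{k}\binom{r+k-1}{k}$, let $L_{r-1}(u)=\sum_{k=0}^{r-1}c_{r,k}u^k$ be the shifted Legendre polynomial of degree $r-1$, let $K_r(t)=\int_0^t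 L_{r-1}(u)\,du$, and let $K=(K_2,\dots,K_\ell)$. Assume that $\mathbb{E}|X_1|<\infty$ and that $$\int_{\mathbb R}\sqrt{\mathbb{F}_T(y)(1-\mathbb{F}_T(y))}\,dy<\infty,\qquad \int_{\mathbb R}\int_{\mathbb R}\big(\mathbb{F}_T(\min(x,y))-\mathbb{F}_T(x)\mathbb{F}_T(y)\big)\,dx\,dy<\infty.$$ Then for every $\phi=(\lambda,\theta,\alpha)\in\Phi$ such that $\int\|K(\mathbb{F}_0(y|\phi))\|\,dy<\infty$ (which holds for instance when $P_1(\cdot|\theta)$ has a finite expectation), the integral $\int K(\hat{\mathbb{F}}_0(y|\phi))\,dy$ converges absolutely for every $n\ge1$, and $$\sqrt n\left[\int K(\hat{\mathbb{F}}_0(y|\phi))\,dy-\int K(\mathbb{F}_0(y|\phi))\,dy\right]\xrightarrow{\ \mathcal D\ }\mathcal N(0,\Sigma),$$ where $\Sigma$ is the positive semidefinite matrix, given by absolutely convergent integrals, with entries $$\Sigma_{r_1,r_2}=\frac{1}{(1-\lambda)^2}\int\!\!\int\big(\mathbb{F}_T(\min(x,y))-\mathbb{F}_T(x)\mathbb{F}_T(y)\big)\sum_{k=0}^{r_1-1}c_{r_1,k}\mathbb{F}_0(x|\phi)^k\sum_{k=0}^{r_2-1}c_{r_2,k}\mathbb{F}_0(y|\phi)^k\,dy\,dx,\qquad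 r_1,r_2\in\{2,\dots,\ell\}.$$ -/

import Mathlib

open MeasureTheory ProbabilityTheory Filter

noncomputable section

/-- The coefficients `c_{r,k}` of the shifted Legendre polynomial of degree `r - 1`
(used for `1 ≤ r` and `k ≤ r - 1`). -/
def legendreCoeff (r k : ℕ) : ℝ :=
  (-1) ^ (r - 1 - k) * ((r - 1).choose k : ℝ) * ((r - 1 + k).choose k : ℝ)

/-- `L_{r-1}(u) = ∑_{k=0}^{r-1} c_{r,k} u^k`, the shifted Legendre polynomial of degree `r - 1`
(orthogonal on `[0, 1]`, with value `1` at `u = 1`). -/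
def legendreL (r : ℕ) (u : ℝ) : ℝ :=
  ∑ k ∈ Finset.range r, legendreCoeff r k * u ^ k

/-- The integrated shifted Legendre polynomial `K_r(t) = ∫_0^t L_{r-1}(u) du`. -/
def lmomentK (r : ℕ) (t : ℝ) : ℝ :=
  ∫ u in (0 : ℝ)..t, legendreL r u

/-- The empirical distribution function `F_n(y)` of the first `n` observations. -/
def empiricalCdf {Ω : Type*} (X : ℕ → Ω → ℝ) (n : ℕ) (ω : Ω) (y : ℝ) : ℝ :=
  (n : ℝ)⁻¹ * ∑ i ∈ Finset.range n, if X i ω ≤ y then 1 else 0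

/-- `y ↦ G(y) / (1 - lam) - lam / (1 - lam) * G₁(y)`: what remains of a mixture distribution
function `G` once the component `G₁`, of proportion `lam`, is removed. -/
def residualCdf (lam : ℝ) (G G₁ : ℝ → ℝ) (y : ℝ) : ℝ :=
  1 / (1 - lam) * G y - lam / (1 - lam) * G₁ y

/-- `F(min(x, y)) - F(x) F(y)`, the covariance kernel of the `F`-Brownian bridge. -/
def bridgeKernel (F : ℝ → ℝ) (x y : ℝ) : ℝ :=
  F (min x y) - F x * F y

/-- The integrand of the entry `(r₁, r₂)` of the limiting covariance matrix, where `F` is the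
distribution function of the data and `F₀` the residual distribution function. -/
def limitCovIntegrand (F F₀ : ℝ → ℝ) (r₁ r₂ : ℕ) (x y : ℝ) : ℝ :=
  bridgeKernel F x y *
    (∑ k ∈ Finset.range r₁, legendreCoeff r₁ k * F₀ x ^ k) *
    (∑ k ∈ Finset.range r₂, legendreCoeff r₂ k * F₀ y ^ k)

/-- The limiting covariance matrix, with rows and columns indexed by `{2, …, ℓ}`. The factor
`(1 - lam)⁻²` is there because the residual built from the empirical distribution function
differs from `F₀` by `(F_n - F) / (1 - lam)`. -/
def limitCov (ℓ : ℕ) (lam : ℝ) (F F₀ : ℝ → ℝ) :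
    Matrix (Finset.Icc 2 ℓ) (Finset.Icc 2 ℓ) ℝ :=
  Matrix.of fun r₁ r₂ =>
    1 / (1 - lam) ^ 2 * ∫ x, ∫ y, limitCovIntegrand F F₀ r₁ r₂ x y

end

/-! The statistic is a smooth functional of `F_n`, linearized at `F_T` with a remainder quadratic in
`F_n - F_T`. Since `F̂₀ - F₀ = (F_n - F_T)/(1 - λ)` and `K_r' = L_{r-1}`, a Taylor expansion on the
fixed compact interval containing all values of `F₀` and `F̂₀` gives `K_r(F̂₀) - K_r(F₀) = w_r (F_n
- F_T) + O((F_n - F_T)²)` with the bounded weight `w_r = L_{r-1}(F₀)/(1 - λ)`. Integrated over `y`,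
the linear term is the empirical mean of the scores `ψ_r(X_i)`, where `ψ_r(x) = ∫ w_r(y) (1{x ≤ y} -
F_T(y)) dy` (`exists_abs_integral_lmomentK_sub_le`).

Integrability of `√(F_T(1 - F_T))` and Cauchy-Schwarz justify Fubini: the scores are centered and
square integrable, with second moments `Σ` (`limitCov_apply_eq_integral`). The multivariate central
limit theorem gives the limit of the linear term. As `E ∫ (F_n - F_T)² = n⁻¹ ∫ F_T(1 - F_T)`, the
remainder times `√n` is `O(n^{-1/2})` in `L¹`, and Slutsky's lemma concludes. -/

/-! ### Second-moment matrices and the multivariate central limit theorem. -/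

section MultivariateCLT

open scoped RealInnerProductSpace Topology

variable {ι : Type*} [Fintype ι] {Ω : Type*} [MeasurableSpace Ω] {μ : Measure Ω}

/-- The quadratic form of a matrix of second moments, as a second moment. -/
theorem Matrix.dotProduct_mulVec_eq_integral_sq {Y : Ω → EuclideanSpace ℝ ι}
    (hY : ∀ i, MemLp (fun ω => Y ω i) 2 μ) {S : Matrix ι ι ℝ}
    (hS : ∀ i j, S i j = ∫ ω, Y ω i * Y ω j ∂μ) (x : ι → ℝ) :
    x ⬝ᵥ S.mulVec x = ∫ ω, (∑ i, x i * Y ω i) ^ 2 ∂μ := by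
  have hint : ∀ i j, Integrable (fun ω => Y ω i * Y ω j) μ := fun i j =>
    (hY i).integrable_mul (hY j)
  simp_rw [sq, Finset.sum_mul_sum]
  rw [integral_finsetSum _ fun i _ => integrable_finsetSum _ fun j _ => by
    simpa [mul_mul_mul_comm] using (hint i j).const_mul (x i * x j)]
  simp only [dotProduct, Matrix.mulVec, Finset.mul_sum]
  refine Finset.sum_congr rfl fun i _ => ?_
  rw [integral_finsetSum _ fun j _ => by
    simpa [mul_mul_mul_comm] using (hint i j).const_mul (x i * x j)]
  refine Finset.sum_congr rfl fun j _ => ?_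
  simp_rw [mul_mul_mul_comm (x i)]
  rw [integral_const_mul, hS]
  ring

/-- The matrix of second moments of a square-integrable random vector is positive semidefinite. -/
theorem Matrix.posSemidef_of_eq_integral_mul {Y : Ω → EuclideanSpace ℝ ι}
    (hY : ∀ i, MemLp (fun ω => Y ω i) 2 μ) {S : Matrix ι ι ℝ}
    (hS : ∀ i j, S i j = ∫ ω, Y ω i * Y ω j ∂μ) : S.PosSemidef := by
  refine Matrix.PosSemidef.of_dotProduct_mulVec_nonneg ?_ fun x => ?_
  · ext i j
    simp [hS, mul_comm]
  · rw [star_trivial, Matrix.dotProduct_mulVec_eq_integral_sq hY hS]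
    exact integral_nonneg fun _ => sq_nonneg _

/-- **Multivariate central limit theorem** for centered i.i.d. square-integrable vectors. -/
theorem tendstoInDistribution_inv_sqrt_smul_sum [DecidableEq ι] [IsProbabilityMeasure μ]
    {Y : ℕ → Ω → EuclideanSpace ℝ ι} (hindep : iIndepFun Y μ)
    (hident : ∀ k, IdentDistrib (Y k) (Y 0) μ μ)
    (hL2 : ∀ i, MemLp (fun ω => Y 0 ω i) 2 μ) (hmean : ∀ i, ∫ ω, Y 0 ω i ∂μ = 0)
    {S : Matrix ι ι ℝ} (hS : ∀ i j, S i j = ∫ ω, Y 0 ω i * Y 0 ω j ∂μ) :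
    TendstoInDistribution (fun (n : ℕ) ω => (√(n : ℝ))⁻¹ • ∑ k ∈ Finset.range n, Y k ω)
      atTop id (fun _ => μ) (multivariateGaussian 0 S) where
  forall_aemeasurable n :=
    .fun_const_smul (Finset.aemeasurable_fun_sum _ fun k _ => (hident k).aemeasurable_fst) _
  tendsto := by
    -- Cramér-Wold: the characteristic function at `t` is that of the scalar projection `⟪·, t⟫` at
    -- `1`, to which the one-dimensional theorem applies.
    refine ProbabilityMeasure.tendsto_iff_tendsto_charFun.2 fun t => ?_
    have hm : ∀ n : ℕ, AEMeasurable (fun ω => (√(n : ℝ))⁻¹ • ∑ k ∈ Finset.range n, Y k ω) μ :=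
      fun n => .fun_const_smul
        (Finset.aemeasurable_fun_sum _ fun k _ => (hident k).aemeasurable_fst) _
    have hinner : ∀ k ω, ⟪Y k ω, t⟫ = ∑ i, t i * Y k ω i := fun k ω => by
      simp [PiLp.inner_apply]
    have hg : Measurable fun v : EuclideanSpace ℝ ι => ⟪v, t⟫ := by fun_prop
    have hV2 : MemLp (fun ω => ⟪Y 0 ω, t⟫) 2 μ := by
      simp_rw [hinner]
      exact memLp_finsetSum _ fun i _ => (hL2 i).const_mul _
    have hV0 : ∫ ω, ⟪Y 0 ω, t⟫ ∂μ = 0 := by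
      simp_rw [hinner]
      rw [integral_finsetSum _ fun i _ => ((hL2 i).integrable one_le_two).const_mul _]
      simp [integral_const_mul, hmean]
    have hvar : Var[fun ω => ⟪Y 0 ω, t⟫; μ] = ⇑t ⬝ᵥ S.mulVec t := by
      rw [variance_of_integral_eq_zero hV2.aemeasurable hV0,
        Matrix.dotProduct_mulVec_eq_integral_sq hL2 hS]
      simp_rw [hinner]
    have hclt := tendstoInDistribution_inv_sqrt_mul_sum_sub
      (X := fun k ω => ⟪Y k ω, t⟫) (Y := id)
      (P' := gaussianReal 0 Var[fun ω => ⟪Y 0 ω, t⟫; μ].toNNReal) (P := μ)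
      ⟨aemeasurable_id, by simp⟩ hV2 (hindep.comp (fun _ v => ⟪v, t⟫) fun _ => hg)
      fun k => (hident k).comp hg
    have h1 := ProbabilityMeasure.tendsto_iff_tendsto_charFun.1 hclt.tendsto 1
    simp only [ProbabilityMeasure.coe_mk, Measure.map_id, hV0, mul_zero, sub_zero,
      charFun_gaussianReal] at h1 ⊢
    rw [charFun_multivariateGaussian (Matrix.posSemidef_of_eq_integral_mul hL2 hS)]
    rw [hvar] at h1
    refine (h1.congr fun n => ?_).trans (le_of_eq ?_)
    · rw [charFun_apply_real, charFun_apply, integral_map (by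
        simpa [Function.comp_def, sum_inner, real_inner_smul_left] using
          hg.comp_aemeasurable (hm n)) (by fun_prop),
        integral_map (hm n) (by fun_prop)]
      simp [sum_inner, real_inner_smul_left]
    -- The quadratic form is a variance, so `toNNReal` does not truncate it.
    · have h0 : 0 ≤ ⇑t ⬝ᵥ S.mulVec t := hvar ▸ variance_nonneg _ _
      simp [h0]

end MultivariateCLT

/-! ### Centered indicators, their covariances and the moments of the scores. -/

section CenteredIndicator

/-- The contribution `1{x ≤ y} - F(y)` of an observation `x` to the empirical process at `y`. -/
noncomputable def centeredIndicator (P : Measure ℝ) (x y : ℝ) : ℝ :=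
  (if x ≤ y then 1 else 0) - cdf P y

/-- The integral of `1{x ≤ y} - F(y)` against a weight `w`. -/
noncomputable def weightedScore (P : Measure ℝ) (w : ℝ → ℝ) (x : ℝ) : ℝ :=
  ∫ y, w y * centeredIndicator P x y

variable (P : Measure ℝ)

theorem measurable_cdf : Measurable (cdf P) := (monotone_cdf P).measurable

theorem measurable_uncurry_centeredIndicator :
    Measurable fun p : ℝ × ℝ => centeredIndicator P p.1 p.2 := by
  unfold centeredIndicator
  refine .sub (.ite (measurableSet_le measurable_fst measurable_snd) ?_ ?_)
    ((measurable_cdf P).comp measurable_snd) <;> fun_prop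

@[fun_prop]
theorem Measurable.centeredIndicator {α : Type*} [MeasurableSpace α] {f g : α → ℝ}
    (hf : Measurable f) (hg : Measurable g) :
    Measurable fun a => centeredIndicator P (f a) (g a) :=
  (measurable_uncurry_centeredIndicator P).comp (hf.prodMk hg)

theorem abs_centeredIndicator_le (x y : ℝ) : |centeredIndicator P x y| ≤ 1 := by
  have h0 := cdf_nonneg P y
  have h1 := cdf_le_one P y
  unfold centeredIndicator
  rw [abs_le]
  split_ifs <;> constructor <;> linarith

theorem weightedScore_mul {w v : ℝ → ℝ} (x : ℝ) : weightedScore P w x * weightedScore P v x =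
    ∫ p : ℝ × ℝ, (w p.1 * centeredIndicator P x p.1) * (v p.2 * centeredIndicator P x p.2) :=
  (integral_prod_mul _ _).symm

/-- Since `t = F(1 - F)` lies in `[0, 1]`, `t ≤ √t`. -/
theorem integrable_cdf_mul_one_sub
    (hsqrt : Integrable (fun y : ℝ => √(cdf P y * (1 - cdf P y)))) :
    Integrable (fun y : ℝ => cdf P y * (1 - cdf P y)) := by
  have hm := measurable_cdf P
  refine hsqrt.mono (by fun_prop) (.of_forall fun y => ?_)
  have h0 := cdf_nonneg P y
  have h1 := cdf_le_one P y
  have h : 0 ≤ cdf P y * (1 - cdf P y) := mul_nonneg h0 (by linarith)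
  rw [Real.norm_of_nonneg h, Real.norm_of_nonneg (Real.sqrt_nonneg _)]
  have h' : cdf P y * (1 - cdf P y) ≤ 1 := by nlinarith
  exact Real.le_sqrt_of_sq_le (by nlinarith)

theorem measurable_weightedScore {w : ℝ → ℝ} (hw : Measurable w) : Measurable (weightedScore P w) := by
  have : Measurable fun p : ℝ × ℝ => w p.2 * centeredIndicator P p.1 p.2 := by fun_prop
  exact this.stronglyMeasurable.integral_prod_right'.measurable

variable [IsProbabilityMeasure P]

theorem memLp_centeredIndicator (y : ℝ) (q : ENNReal) :
    MemLp (fun x => centeredIndicator P x y) q P :=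
  .of_bound (by fun_prop) 1 (.of_forall fun x => abs_centeredIndicator_le P x y)

theorem integral_indicator_le_eq_cdf (y : ℝ) : ∫ x, (if x ≤ y then (1 : ℝ) else 0) ∂P = cdf P y := by
  rw [cdf_eq_real, ← integral_indicator_one measurableSet_Iic]
  simp [Set.indicator_apply]

theorem integrable_indicator_le (y : ℝ) : Integrable (fun x => if x ≤ y then (1 : ℝ) else 0) P :=
  .of_bound (Measurable.ite measurableSet_Iic (by fun_prop) (by fun_prop)).aestronglyMeasurable 1
    (.of_forall fun x => by split_ifs <;> simp)

theorem integral_centeredIndicator (y : ℝ) : ∫ x, centeredIndicator P x y ∂P = 0 := by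
  unfold centeredIndicator
  rw [integral_sub (integrable_indicator_le P y) (integrable_const _),
    integral_indicator_le_eq_cdf]
  simp

/-- The covariance of the empirical process at two points is the Brownian bridge kernel. -/
theorem integral_centeredIndicator_mul (y z : ℝ) :
    ∫ x, centeredIndicator P x y * centeredIndicator P x z ∂P = bridgeKernel (cdf P) y z := by
  -- The product of the two indicators is the indicator of `x ≤ min y z`; the last term is kept
  -- centered so that its integral vanishes.
  have h : ∀ x, centeredIndicator P x y * centeredIndicator P x z =
      (if x ≤ min y z then 1 else 0) - cdf P z * (if x ≤ y then 1 else 0) -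
        cdf P y * centeredIndicator P x z := fun x => by
    unfold centeredIndicator
    by_cases hy : x ≤ y <;> by_cases hz : x ≤ z <;> simp [hy, hz] <;> ring
  simp_rw [h]
  have h1 : Integrable (fun x => (if x ≤ min y z then (1 : ℝ) else 0) -
      cdf P z * (if x ≤ y then (1 : ℝ) else 0)) P :=
    (integrable_indicator_le P _).sub ((integrable_indicator_le P _).const_mul _)
  rw [integral_sub h1 (((memLp_centeredIndicator P z 1).integrable le_rfl).const_mul _),
    integral_sub (integrable_indicator_le P _) ((integrable_indicator_le P _).const_mul _),
    integral_const_mul, integral_const_mul, integral_centeredIndicator,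
    integral_indicator_le_eq_cdf, integral_indicator_le_eq_cdf, bridgeKernel]
  ring

theorem integral_sq_centeredIndicator (y : ℝ) :
    ∫ x, centeredIndicator P x y ^ 2 ∂P = cdf P y * (1 - cdf P y) := by
  simp_rw [sq, integral_centeredIndicator_mul, bridgeKernel, min_self]
  ring

/-- Cauchy-Schwarz; the product form of the bound makes it integrable in `(y, z)`. -/
theorem integral_abs_centeredIndicator_mul_le (y z : ℝ) :
    ∫ x, |centeredIndicator P x y * centeredIndicator P x z| ∂P ≤
      √(cdf P y * (1 - cdf P y)) * √(cdf P z * (1 - cdf P z)) := by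
  have h := integral_mul_norm_le_Lp_mul_Lq (μ := P) Real.HolderConjugate.two_two
    (by simpa using memLp_centeredIndicator P y 2) (by simpa using memLp_centeredIndicator P z 2)
  simpa [abs_mul, integral_sq_centeredIndicator, Real.sqrt_eq_rpow] using h

theorem integral_abs_centeredIndicator_le (y : ℝ) :
    ∫ x, |centeredIndicator P x y| ∂P ≤ √(cdf P y * (1 - cdf P y)) := by
  have h := integral_mul_norm_le_Lp_mul_Lq (μ := P) Real.HolderConjugate.two_two
    (by simpa using memLp_centeredIndicator P y 2) (by simpa using memLp_const (μ := P) (1 : ℝ))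
  simpa [integral_sq_centeredIndicator, Real.sqrt_eq_rpow] using h

/-- Tonelli, integrating first in `x`: the inner integral of the absolute value is at most `√(F(1 -
F))`. -/
theorem integrable_uncurry_centeredIndicator
    (hsqrt : Integrable (fun y : ℝ => √(cdf P y * (1 - cdf P y)))) :
    Integrable (fun p : ℝ × ℝ => centeredIndicator P p.1 p.2) (P.prod volume) := by
  refine (integrable_prod_iff' (by fun_prop)).2 ⟨.of_forall fun y =>
    (memLp_centeredIndicator P y 1).integrable le_rfl, hsqrt.mono' ?_ (.of_forall fun y => ?_)⟩
  · have : Measurable fun p : ℝ × ℝ => ‖centeredIndicator P p.2 p.1‖ := by fun_prop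
    exact this.aestronglyMeasurable.integral_prod_right' (ν := P)
  · rw [Real.norm_of_nonneg (integral_nonneg fun _ => norm_nonneg _)]
    exact integral_abs_centeredIndicator_le P y

/-- `y ↦ 1{x ≤ y} - F(y)` is integrable for every `x`. -/
theorem integrable_centeredIndicator
    (hsqrt : Integrable (fun y : ℝ => √(cdf P y * (1 - cdf P y)))) (x : ℝ) :
    Integrable (centeredIndicator P x) := by
  -- Fubini yields integrability for almost every `x`, hence for some `x₀`. Moving from `x₀` to `x`
  -- changes the function only between the two points, by at most `1`.
  obtain ⟨x₀, hx₀⟩ := (integrable_uncurry_centeredIndicator P hsqrt).prod_right_ae.exists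
  have hd : Integrable fun y => centeredIndicator P x y - centeredIndicator P x₀ y := by
    have hI : Integrable ((Set.Icc (min x x₀) (max x x₀)).indicator fun _ => (1 : ℝ)) :=
      (integrable_indicator_iff measurableSet_Icc).2 (integrableOn_const (by simp))
    refine hI.mono' (by fun_prop) (.of_forall fun y => ?_)
    unfold centeredIndicator
    by_cases h1 : x ≤ y <;> by_cases h2 : x₀ ≤ y
    · simp [Set.indicator_apply, h1, h2]
      split_ifs <;> simp
    · simp [h1, h2, (not_le.1 h2).le]
    · have : -cdf P y - (1 - cdf P y) = -1 := by ring
      simp [h1, h2, (not_le.1 h1).le, this]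
    · simp [h1, h2]
  exact (hd.add hx₀).congr (.of_forall fun y => by simp)

variable {w v : ℝ → ℝ} {C D : ℝ}

theorem integrable_mul_centeredIndicator
    (hsqrt : Integrable (fun y : ℝ => √(cdf P y * (1 - cdf P y))))
    (hw : Measurable w) (hC : ∀ y, |w y| ≤ C) (x : ℝ) :
    Integrable (fun y => w y * centeredIndicator P x y) :=
  (integrable_centeredIndicator P hsqrt x).bdd_mul (c := C) (by fun_prop) (.of_forall hC)

theorem integral_weightedScore
    (hsqrt : Integrable (fun y : ℝ => √(cdf P y * (1 - cdf P y))))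
    (hw : Measurable w) (hC : ∀ y, |w y| ≤ C) : ∫ x, weightedScore P w x ∂P = 0 := by
  unfold weightedScore
  rw [integral_integral_swap]
  · simp [integral_const_mul, integral_centeredIndicator]
  · exact (integrable_uncurry_centeredIndicator P hsqrt).bdd_mul (c := C)
      (hw.comp measurable_snd).aestronglyMeasurable (.of_forall fun p => hC p.2)

/-- Bounded weights reduce this to `w = v = 1`, where Tonelli applies with the Cauchy-Schwarz bound.
It yields both the square integrability and the covariances of the scores. -/
theorem integrable_centeredIndicator_mul
    (hsqrt : Integrable (fun y : ℝ => √(cdf P y * (1 - cdf P y))))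
    (hw : Measurable w) (hC : ∀ y, |w y| ≤ C) (hv : Measurable v) (hD : ∀ y, |v y| ≤ D) :
    Integrable (fun p : ℝ × (ℝ × ℝ) => (w p.2.1 * centeredIndicator P p.1 p.2.1) *
      (v p.2.2 * centeredIndicator P p.1 p.2.2)) (P.prod (volume.prod volume)) := by
  have h : Integrable (fun p : ℝ × (ℝ × ℝ) => centeredIndicator P p.1 p.2.1 *
      centeredIndicator P p.1 p.2.2) (P.prod (volume.prod volume)) := by
    refine (integrable_prod_iff' (by fun_prop)).2 ⟨.of_forall fun p =>
      (memLp_centeredIndicator P p.1 2).integrable_mul (memLp_centeredIndicator P p.2 2),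
      (hsqrt.mul_prod hsqrt).mono' ?_ (.of_forall fun p => ?_)⟩
    · have : Measurable fun q : (ℝ × ℝ) × ℝ =>
          ‖centeredIndicator P q.2 q.1.1 * centeredIndicator P q.2 q.1.2‖ := by fun_prop
      exact this.aestronglyMeasurable.integral_prod_right' (ν := P)
    · rw [Real.norm_of_nonneg (integral_nonneg fun _ => norm_nonneg _)]
      exact integral_abs_centeredIndicator_mul_le P p.1 p.2
  refine (h.bdd_mul (c := C * D) (f := fun p : ℝ × (ℝ × ℝ) => w p.2.1 * v p.2.2) (by fun_prop)
    (.of_forall fun p => ?_)).congr (.of_forall fun p => by ring)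
  rw [norm_mul]
  exact mul_le_mul (hC _) (hD _) (norm_nonneg _) ((abs_nonneg _).trans (hC 0))

theorem integral_weightedScore_mul
    (hsqrt : Integrable (fun y : ℝ => √(cdf P y * (1 - cdf P y))))
    (hw : Measurable w) (hC : ∀ y, |w y| ≤ C) (hv : Measurable v) (hD : ∀ y, |v y| ≤ D) :
    ∫ x, weightedScore P w x * weightedScore P v x ∂P =
      ∫ p : ℝ × ℝ, bridgeKernel (cdf P) p.1 p.2 * w p.1 * v p.2 := by
  simp_rw [weightedScore_mul]
  rw [integral_integral_swap (integrable_centeredIndicator_mul P hsqrt hw hC hv hD)]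
  refine integral_congr_ae (.of_forall fun p => ?_)
  simp_rw [mul_mul_mul_comm (w _)]
  rw [integral_const_mul, integral_centeredIndicator_mul]
  ring

theorem memLp_two_weightedScore
    (hsqrt : Integrable (fun y : ℝ => √(cdf P y * (1 - cdf P y))))
    (hw : Measurable w) (hC : ∀ y, |w y| ≤ C) : MemLp (weightedScore P w) 2 P := by
  rw [memLp_two_iff_integrable_sq (measurable_weightedScore P hw).aestronglyMeasurable]
  simp_rw [sq, weightedScore_mul]
  exact (integrable_centeredIndicator_mul P hsqrt hw hC hw hC).integral_prod_left

end CenteredIndicator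

/-! ### Taylor expansion of the integrated Legendre polynomials. -/

section Legendre

@[fun_prop]
theorem continuous_legendreL (r : ℕ) : Continuous (legendreL r) := by
  unfold legendreL
  fun_prop

theorem exists_abs_legendreL_le (r : ℕ) (M : ℝ) :
    ∃ C, ∀ u ∈ Set.Icc (-M) M, |legendreL r u| ≤ C :=
  isCompact_Icc.exists_bound_of_continuousOn (continuous_legendreL r).continuousOn

theorem hasDerivAt_lmomentK (r : ℕ) (t : ℝ) : HasDerivAt (lmomentK r) (legendreL r t) t :=
  intervalIntegral.integral_hasDerivAt_right ((continuous_legendreL r).intervalIntegrable _ _)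
    ((continuous_legendreL r).stronglyMeasurableAtFilter _ _) (continuous_legendreL r).continuousAt

@[fun_prop]
theorem continuous_lmomentK (r : ℕ) : Continuous (lmomentK r) :=
  continuous_iff_continuousAt.2 fun t => (hasDerivAt_lmomentK r t).continuousAt

/-- First-order Taylor expansion of `lmomentK r` with a quadratic remainder, uniformly on a
bounded interval. -/
theorem exists_lmomentK_taylor (r : ℕ) (M : ℝ) :
    ∃ C, ∀ a ∈ Set.Icc (-M) M, ∀ b ∈ Set.Icc (-M) M,
      |lmomentK r b - lmomentK r a - legendreL r a * (b - a)| ≤ C * (b - a) ^ 2 := by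
  have hsmooth : ContDiff ℝ 1 (legendreL r) := by
    unfold legendreL
    fun_prop
  -- `C` is a Lipschitz constant of `legendreL r`; the remainder is the integral of `legendreL r u -
  -- legendreL r a` over `u` from `a` to `b`.
  obtain ⟨C, hC⟩ := hsmooth.contDiffOn.exists_lipschitzOnWith (s := Set.Icc (-M) M)
    one_ne_zero (convex_Icc _ _) isCompact_Icc
  refine ⟨C, fun a ha b hb => ?_⟩
  have hi : ∀ x y, IntervalIntegrable (legendreL r) volume x y := fun x y =>
    (continuous_legendreL r).intervalIntegrable x y
  have hEq : lmomentK r b - lmomentK r a - legendreL r a * (b - a) =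
      ∫ u in a..b, (legendreL r u - legendreL r a) := by
    rw [intervalIntegral.integral_sub (hi a b) (by simp), intervalIntegral.integral_const,
      lmomentK, lmomentK, intervalIntegral.integral_interval_sub_left (hi _ _) (hi _ _), smul_eq_mul,
      mul_comm (b - a)]
  rw [hEq, ← Real.norm_eq_abs]
  refine (intervalIntegral.norm_integral_le_of_norm_le_const (C := C * |b - a|)
    fun u hu => ?_).trans_eq (by rw [mul_assoc, ← abs_mul, abs_mul_self, sq])
  have hu' : u ∈ Set.uIcc a b := Set.uIoc_subset_uIcc hu
  have huM : u ∈ Set.Icc (-M) M := (convex_Icc (-M) M).ordConnected.uIcc_subset ha hb hu'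
  refine (hC.norm_sub_le huM ha).trans ?_
  gcongr
  rw [Real.norm_eq_abs]
  exact Set.abs_sub_left_of_mem_uIcc hu'

end Legendre

/-! ### Bounds for the residual distribution function and the weights. -/

section Residual

variable {lam : ℝ} {G F G₁ : ℝ → ℝ}

/-- `G - lam * G₁` lies in `[-1, 1]`. A residual may leave `[0, 1]`, but a compact interval
independent of `n`, `ω` and `y` is all that the expansion needs. -/
theorem residualCdf_mem_Icc (hlam : lam ∈ Set.Ioo (0 : ℝ) 1) {y : ℝ}
    (hG : G y ∈ Set.Icc (0 : ℝ) 1) (hG₁ : G₁ y ∈ Set.Icc (0 : ℝ) 1) :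
    residualCdf lam G G₁ y ∈ Set.Icc (-(1 - lam)⁻¹) (1 - lam)⁻¹ := by
  obtain ⟨h0, h1⟩ := hlam
  obtain ⟨hG0, hG1⟩ := hG
  obtain ⟨hH0, hH1⟩ := hG₁
  have hpos : 0 < (1 - lam)⁻¹ := inv_pos.2 (by linarith)
  have h : residualCdf lam G G₁ y = (1 - lam)⁻¹ * (G y - lam * G₁ y) := by
    unfold residualCdf
    ring
  rw [h]
  constructor <;> nlinarith [mul_nonneg h0.le hH0, mul_le_mul h1.le hH1 hH0 zero_le_one]

theorem residualCdf_sub_residualCdf (y : ℝ) :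
    residualCdf lam G G₁ y - residualCdf lam F G₁ y = (1 - lam)⁻¹ * (G y - F y) := by
  unfold residualCdf
  ring

theorem cdf_mem_Icc (P : Measure ℝ) (y : ℝ) : cdf P y ∈ Set.Icc (0 : ℝ) 1 :=
  ⟨cdf_nonneg P y, cdf_le_one P y⟩

theorem measurable_residualCdf_cdf (P Q : Measure ℝ) :
    Measurable (residualCdf lam (cdf P) (cdf Q)) := by
  have := measurable_cdf P
  have := measurable_cdf Q
  unfold residualCdf
  fun_prop

variable (P Q : Measure ℝ)

/-- The weight `y ↦ L_{r-1}(F₀(y)) / (1 - lam)` in the linearization of the statistic. -/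
noncomputable def lmomentWeight (lam : ℝ) (P Q : Measure ℝ) (r : ℕ) (y : ℝ) : ℝ :=
  (1 - lam)⁻¹ * legendreL r (residualCdf lam (cdf P) (cdf Q) y)

theorem measurable_lmomentWeight (r : ℕ) : Measurable (lmomentWeight lam P Q r) := by
  have := measurable_residualCdf_cdf (lam := lam) P Q
  have := (continuous_legendreL r).measurable
  unfold lmomentWeight
  fun_prop

theorem exists_abs_lmomentWeight_le (hlam : lam ∈ Set.Ioo (0 : ℝ) 1) (r : ℕ) :
    ∃ C, ∀ y, |lmomentWeight lam P Q r y| ≤ C := by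
  obtain ⟨C, hC⟩ := exists_abs_legendreL_le r (1 - lam)⁻¹
  refine ⟨|(1 - lam)⁻¹| * C, fun y => ?_⟩
  rw [lmomentWeight, abs_mul]
  exact mul_le_mul_of_nonneg_left
    (hC _ (residualCdf_mem_Icc hlam (cdf_mem_Icc P y) (cdf_mem_Icc Q y))) (abs_nonneg _)

end Residual

/-! ### Linearization of the statistic, for each fixed outcome. -/

section EmpiricalProcess

variable {Ω : Type*} (X : ℕ → Ω → ℝ) (P : Measure ℝ)

/-- The centered empirical distribution function `F_n - F`, for `n ≥ 1`. -/
noncomputable def empiricalDeviation (n : ℕ) (ω : Ω) (y : ℝ) : ℝ :=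
  (n : ℝ)⁻¹ * ∑ i ∈ Finset.range n, centeredIndicator P (X i ω) y

theorem empiricalCdf_mem_Icc (n : ℕ) (ω : Ω) (y : ℝ) :
    empiricalCdf X n ω y ∈ Set.Icc (0 : ℝ) 1 := by
  unfold empiricalCdf
  refine ⟨mul_nonneg (by positivity) (Finset.sum_nonneg fun i _ => by split_ifs <;> simp), ?_⟩
  refine (mul_le_mul_of_nonneg_left (Finset.sum_le_sum (g := fun _ => (1 : ℝ))
    fun i _ => by split_ifs <;> simp) (by positivity)).trans ?_
  simpa using inv_mul_le_one

/-- For `n = 0` the convention `0⁻¹ = 0` makes the left side `-F(y)` and the right side `0`. -/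
theorem empiricalCdf_sub_cdf {n : ℕ} (hn : 1 ≤ n) (ω : Ω) (y : ℝ) :
    empiricalCdf X n ω y - cdf P y = empiricalDeviation X P n ω y := by
  have : (n : ℝ) ≠ 0 := by positivity
  simp only [empiricalCdf, empiricalDeviation, centeredIndicator, Finset.sum_sub_distrib,
    Finset.sum_const, Finset.card_range, nsmul_eq_mul]
  field_simp

theorem abs_empiricalDeviation_le (n : ℕ) (ω : Ω) (y : ℝ) :
    |empiricalDeviation X P n ω y| ≤ 1 := by
  unfold empiricalDeviation
  rw [abs_mul, abs_of_nonneg (by positivity : (0 : ℝ) ≤ (n : ℝ)⁻¹)]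
  refine (mul_le_mul_of_nonneg_left ((Finset.abs_sum_le_sum_abs _ _).trans
    (Finset.sum_le_sum (g := fun _ => (1 : ℝ)) fun i _ => abs_centeredIndicator_le P _ y))
    (by positivity)).trans ?_
  simpa using inv_mul_le_one

variable [IsProbabilityMeasure P]

theorem integrable_empiricalDeviation
    (hsqrt : Integrable (fun y : ℝ => √(cdf P y * (1 - cdf P y)))) (n : ℕ) (ω : Ω) :
    Integrable (empiricalDeviation X P n ω) :=
  (integrable_finsetSum _ fun i _ => integrable_centeredIndicator P hsqrt (X i ω)).const_mul _

theorem integrable_sq_empiricalDeviation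
    (hsqrt : Integrable (fun y : ℝ => √(cdf P y * (1 - cdf P y)))) (n : ℕ) (ω : Ω) :
    Integrable fun y => empiricalDeviation X P n ω y ^ 2 := by
  have h := integrable_empiricalDeviation X P hsqrt n ω
  simp_rw [sq]
  exact h.bdd_mul (c := 1) h.aestronglyMeasurable
    (.of_forall fun y => abs_empiricalDeviation_le X P n ω y)

variable {lam : ℝ} (Q : Measure ℝ)

/-- The statistic `∫ K_r(F̂₀)` is finite, and its deviation from `∫ K_r(F₀)` is an empirical mean
of scores up to a term of the order of `∫ (F_n - F)²`. -/
theorem exists_abs_integral_lmomentK_sub_le (hlam : lam ∈ Set.Ioo (0 : ℝ) 1)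
    (hsqrt : Integrable (fun y : ℝ => √(cdf P y * (1 - cdf P y)))) (r : ℕ)
    (hK : Integrable fun y => lmomentK r (residualCdf lam (cdf P) (cdf Q) y)) :
    ∃ C, ∀ n : ℕ, 1 ≤ n → ∀ ω,
      Integrable (fun y => lmomentK r (residualCdf lam (empiricalCdf X n ω) (cdf Q) y)) ∧
      |(∫ y, lmomentK r (residualCdf lam (empiricalCdf X n ω) (cdf Q) y)) -
          (∫ y, lmomentK r (residualCdf lam (cdf P) (cdf Q) y)) -
          (n : ℝ)⁻¹ * ∑ i ∈ Finset.range n, weightedScore P (lmomentWeight lam P Q r) (X i ω)| ≤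
        C * ∫ y, empiricalDeviation X P n ω y ^ 2 := by
  obtain ⟨C, hC⟩ := exists_lmomentK_taylor r (1 - lam)⁻¹
  obtain ⟨B, hB⟩ := exists_abs_lmomentWeight_le P Q hlam r
  have hwm := measurable_lmomentWeight (lam := lam) P Q r
  refine ⟨C * (1 - lam)⁻¹ ^ 2, fun n hn ω => ?_⟩
  set D := empiricalDeviation X P n ω with hD
  have hDi : Integrable D := integrable_empiricalDeviation X P hsqrt n ω
  have hD2 : Integrable fun y => D y ^ 2 := integrable_sq_empiricalDeviation X P hsqrt n ω
  have hwD : Integrable fun y => lmomentWeight lam P Q r y * D y :=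
    hDi.bdd_mul (c := B) hwm.aestronglyMeasurable (.of_forall hB)
  have hsub : ∀ y, residualCdf lam (empiricalCdf X n ω) (cdf Q) y -
      residualCdf lam (cdf P) (cdf Q) y = (1 - lam)⁻¹ * D y := fun y => by
    rw [residualCdf_sub_residualCdf, empiricalCdf_sub_cdf X P hn]
  -- The Taylor remainder. It is dominated by a multiple of `D²`, so `K_r(F̂₀)` is a sum of three
  -- integrable functions: `R`, the linear term and `K_r(F₀)`.
  set R : ℝ → ℝ := fun y => lmomentK r (residualCdf lam (empiricalCdf X n ω) (cdf Q) y) -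
    lmomentK r (residualCdf lam (cdf P) (cdf Q) y) - lmomentWeight lam P Q r y * D y with hR
  have hRle : ∀ y, |R y| ≤ C * (1 - lam)⁻¹ ^ 2 * D y ^ 2 := fun y => by
    have h := hC _ (residualCdf_mem_Icc hlam (cdf_mem_Icc P y) (cdf_mem_Icc Q y)) _
      (residualCdf_mem_Icc hlam (empiricalCdf_mem_Icc X n ω y) (cdf_mem_Icc Q y))
    rw [hsub, mul_pow, ← mul_assoc C] at h
    simpa only [hR, lmomentWeight, mul_assoc, mul_left_comm] using h
  have hRm : AEStronglyMeasurable R volume := by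
    have hFm : AEMeasurable (residualCdf lam (empiricalCdf X n ω) (cdf Q)) :=
      (((hDi.aemeasurable.const_mul (1 - lam)⁻¹).add
        (measurable_residualCdf_cdf (lam := lam) P Q).aemeasurable)).congr
          (.of_forall fun y => by simp [← hsub])
    exact ((((continuous_lmomentK r).measurable.comp_aemeasurable hFm).aestronglyMeasurable).sub
      hK.aestronglyMeasurable).sub hwD.aestronglyMeasurable
  have hRi : Integrable R :=
    (hD2.const_mul (C * (1 - lam)⁻¹ ^ 2)).mono' hRm (.of_forall hRle)
  have hKn : Integrable fun y => lmomentK r (residualCdf lam (empiricalCdf X n ω) (cdf Q) y) :=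
    ((hRi.add hwD).add hK).congr (.of_forall fun y => by simp [hR])
  refine ⟨hKn, ?_⟩
  have hlin : (n : ℝ)⁻¹ * ∑ i ∈ Finset.range n,
      weightedScore P (lmomentWeight lam P Q r) (X i ω) =
        ∫ y, lmomentWeight lam P Q r y * D y := by
    unfold weightedScore
    rw [← integral_finsetSum _ fun i _ => integrable_mul_centeredIndicator P hsqrt hwm hB _,
      ← integral_const_mul]
    congr with y
    rw [hD, empiricalDeviation, ← Finset.mul_sum]
    ring
  rw [hlin, ← integral_sub hKn hK, ← integral_sub (f := fun y => _ - _) (hKn.sub hK) hwD, ← integral_const_mul]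
  exact abs_integral_le_integral_abs.trans
    (integral_mono hRi.abs (hD2.const_mul _) hRle)

end EmpiricalProcess

/-! ### Mean integrated squared error of `F_n`. -/

section MeanSquare

variable {Ω : Type*} [MeasurableSpace Ω] {μ : Measure Ω}
  {P : Measure ℝ} {X : ℕ → Ω → ℝ}

theorem aemeasurable_uncurry_empiricalDeviation (hX : ∀ i, AEMeasurable (X i) μ) (n : ℕ) :
    AEMeasurable (fun p : Ω × ℝ => empiricalDeviation X P n p.1 p.2) (μ.prod volume) :=
  (Finset.aemeasurable_fun_sum _ fun i _ =>
    (measurable_uncurry_centeredIndicator P).comp_aemeasurable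
      ((hX i).comp_fst.prodMk measurable_snd.aemeasurable)).const_mul _

theorem aemeasurable_uncurry_empiricalCdf (hX : ∀ i, AEMeasurable (X i) μ) (n : ℕ) :
    AEMeasurable (fun p : Ω × ℝ => empiricalCdf X n p.1 p.2) (μ.prod volume) := by
  have h : Measurable fun p : ℝ × ℝ => if p.1 ≤ p.2 then (1 : ℝ) else 0 :=
    .ite (measurableSet_le measurable_fst measurable_snd) (by fun_prop) (by fun_prop)
  exact (Finset.aemeasurable_fun_sum _ fun i _ => h.comp_aemeasurable
    ((hX i).comp_fst.prodMk measurable_snd.aemeasurable)).const_mul _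

variable [IsProbabilityMeasure μ]

theorem memLp_centeredIndicator_comp (hlaw : ∀ i, HasLaw (X i) P μ) (i : ℕ) (y : ℝ) :
    MemLp (fun ω => centeredIndicator P (X i ω) y) 2 μ :=
  .of_bound ((Measurable.centeredIndicator P measurable_id measurable_const).comp_aemeasurable
    (hlaw i).aemeasurable).aestronglyMeasurable 1
    (.of_forall fun _ => abs_centeredIndicator_le P _ y)

variable [IsProbabilityMeasure P]

/-- The summands are centered and independent, so their variances add up. -/
theorem integral_sq_empiricalDeviation (hlaw : ∀ i, HasLaw (X i) P μ) (hindep : iIndepFun X μ)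
    (n : ℕ) (y : ℝ) :
    ∫ ω, empiricalDeviation X P n ω y ^ 2 ∂μ = (n : ℝ)⁻¹ * (cdf P y * (1 - cdf P y)) := by
  have hm : Measurable fun x => centeredIndicator P x y := by fun_prop
  have hL2 := fun i => memLp_centeredIndicator_comp hlaw i y
  have h0 : ∀ i, ∫ ω, centeredIndicator P (X i ω) y ∂μ = 0 := fun i =>
    ((hlaw i).integral_comp hm.aestronglyMeasurable).trans (integral_centeredIndicator P y)
  have hv : ∀ i, Var[fun ω => centeredIndicator P (X i ω) y; μ] = cdf P y * (1 - cdf P y) :=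
    fun i => by
      rw [variance_of_integral_eq_zero (hL2 i).aemeasurable (h0 i)]
      exact ((hlaw i).integral_comp (hm.pow_const 2).aestronglyMeasurable).trans
        (integral_sq_centeredIndicator P y)
  have hsum : Var[∑ i ∈ Finset.range n, fun ω => centeredIndicator P (X i ω) y; μ] =
      n * (cdf P y * (1 - cdf P y)) := by
    rw [IndepFun.variance_sum (fun i _ => hL2 i) fun i _ j _ hij =>
      (hindep.indepFun hij).comp hm hm]
    simp [hv]
  have hsum0 : ∫ ω, (∑ i ∈ Finset.range n, fun ω => centeredIndicator P (X i ω) y) ω ∂μ = 0 := by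
    simp_rw [Finset.sum_apply]
    rw [integral_finsetSum _ fun i _ => (hL2 i).integrable one_le_two]
    simp [h0]
  rw [variance_of_integral_eq_zero (memLp_finsetSum' _ fun i _ => hL2 i).aemeasurable hsum0] at hsum
  simp only [Finset.sum_apply] at hsum
  simp_rw [empiricalDeviation, mul_pow]
  rw [integral_const_mul, hsum]
  rcases eq_or_ne (n : ℝ) 0 with hn | hn
  · simp [hn]
  · field_simp

theorem integrable_uncurry_sq_empiricalDeviation
    (hlaw : ∀ i, HasLaw (X i) P μ) (hindep : iIndepFun X μ)
    (hsqrt : Integrable (fun y : ℝ => √(cdf P y * (1 - cdf P y)))) (n : ℕ) :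
    Integrable (fun p : Ω × ℝ => empiricalDeviation X P n p.1 p.2 ^ 2) (μ.prod volume) := by
  have hm := aemeasurable_uncurry_empiricalDeviation (P := P) (fun i => (hlaw i).aemeasurable) n
  refine (integrable_prod_iff' (hm.pow_const 2).aestronglyMeasurable).2
    ⟨.of_forall fun y => MemLp.integrable_sq ?_, ?_⟩
  · exact (memLp_finsetSum _ fun i _ => memLp_centeredIndicator_comp hlaw i y).const_mul _
  · simp only [norm_pow, Real.norm_eq_abs, sq_abs, integral_sq_empiricalDeviation hlaw hindep]
    exact (integrable_cdf_mul_one_sub P hsqrt).const_mul _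

/-- The mean integrated squared error of the empirical distribution function. -/
theorem integral_integral_sq_empiricalDeviation
    (hlaw : ∀ i, HasLaw (X i) P μ) (hindep : iIndepFun X μ)
    (hsqrt : Integrable (fun y : ℝ => √(cdf P y * (1 - cdf P y)))) (n : ℕ) :
    ∫ ω, (∫ y, empiricalDeviation X P n ω y ^ 2) ∂μ =
      (n : ℝ)⁻¹ * ∫ y, cdf P y * (1 - cdf P y) := by
  rw [integral_integral_swap (integrable_uncurry_sq_empiricalDeviation hlaw hindep hsqrt n)]
  simp_rw [integral_sq_empiricalDeviation hlaw hindep]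
  exact integral_const_mul _ _

end MeanSquare

/-! ### Covariance identity, negligible remainder and convergence in distribution. -/

section LimitTheorem

open scoped Topology

variable {lam : ℝ} (P Q : Measure ℝ)

theorem integrable_limitCovIntegrand (hlam : lam ∈ Set.Ioo (0 : ℝ) 1)
    (hkernel : Integrable (fun p : ℝ × ℝ => bridgeKernel (cdf P) p.1 p.2)) (r₁ r₂ : ℕ) :
    Integrable fun p : ℝ × ℝ =>
      limitCovIntegrand (cdf P) (residualCdf lam (cdf P) (cdf Q)) r₁ r₂ p.1 p.2 := by
  have hL : ∀ r, ∃ C, ∀ y, |legendreL r (residualCdf lam (cdf P) (cdf Q) y)| ≤ C := fun r =>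
    let ⟨C, hC⟩ := exists_abs_legendreL_le r (1 - lam)⁻¹
    ⟨C, fun y => hC _ (residualCdf_mem_Icc hlam (cdf_mem_Icc P y) (cdf_mem_Icc Q y))⟩
  have hm : ∀ r, Measurable fun y => legendreL r (residualCdf lam (cdf P) (cdf Q) y) := fun r =>
    (continuous_legendreL r).measurable.comp (measurable_residualCdf_cdf P Q)
  obtain ⟨C₁, h₁⟩ := hL r₁
  obtain ⟨C₂, h₂⟩ := hL r₂
  exact (hkernel.mul_bdd (c := C₁) ((hm r₁).comp measurable_fst).aestronglyMeasurable
    (.of_forall fun p => h₁ p.1)).mul_bdd (c := C₂)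
      ((hm r₂).comp measurable_snd).aestronglyMeasurable (.of_forall fun p => h₂ p.2)

/-- The vector of scores `(∫ L_{r-1}(F₀(y)) (1{x ≤ y} - F(y)) dy / (1 - lam))_r`. -/
noncomputable def lmomentScore (lam : ℝ) (P Q : Measure ℝ) (ℓ : ℕ) (x : ℝ) :
    EuclideanSpace ℝ (Finset.Icc 2 ℓ) :=
  WithLp.toLp 2 fun r => weightedScore P (lmomentWeight lam P Q r) x

theorem measurable_lmomentScore (ℓ : ℕ) : Measurable (lmomentScore lam P Q ℓ) :=
  (WithLp.measurable_toLp 2 _).comp (measurable_pi_lambda _ fun r =>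
    measurable_weightedScore P (measurable_lmomentWeight P Q r))

variable {Ω : Type*} [MeasurableSpace Ω] {μ : Measure Ω} {X : ℕ → Ω → ℝ}

theorem aemeasurable_integral_lmomentK [SFinite μ] (hX : ∀ i, AEMeasurable (X i) μ) (r n : ℕ) :
    AEMeasurable
      (fun ω => ∫ y, lmomentK r (residualCdf lam (empiricalCdf X n ω) (cdf Q) y)) μ := by
  have h1 : AEMeasurable (fun p : Ω × ℝ =>
      residualCdf lam (empiricalCdf X n p.1) (cdf Q) p.2) (μ.prod volume) :=
    ((aemeasurable_uncurry_empiricalCdf hX n).const_mul _).sub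
      (((measurable_cdf Q).comp measurable_snd).const_mul _).aemeasurable
  exact ((continuous_lmomentK r).measurable.comp_aemeasurable
    h1).aestronglyMeasurable.integral_prod_right'.aemeasurable

variable [IsProbabilityMeasure P]

/-- The two weights supply the factor `(1 - lam)⁻²`, and integrability of the kernel turns the
iterated integral into a double one. Positive semidefiniteness follows from this identity too. -/
theorem limitCov_apply_eq_integral (hlam : lam ∈ Set.Ioo (0 : ℝ) 1) {ℓ : ℕ}
    (hsqrt : Integrable (fun y : ℝ => √(cdf P y * (1 - cdf P y))))
    (hkernel : Integrable (fun p : ℝ × ℝ => bridgeKernel (cdf P) p.1 p.2))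
    (r₁ r₂ : Finset.Icc 2 ℓ) :
    limitCov ℓ lam (cdf P) (residualCdf lam (cdf P) (cdf Q)) r₁ r₂ =
      ∫ x, weightedScore P (lmomentWeight lam P Q r₁) x *
        weightedScore P (lmomentWeight lam P Q r₂) x ∂P := by
  obtain ⟨C₁, h₁⟩ := exists_abs_lmomentWeight_le P Q hlam r₁
  obtain ⟨C₂, h₂⟩ := exists_abs_lmomentWeight_le P Q hlam r₂
  rw [integral_weightedScore_mul P hsqrt (measurable_lmomentWeight P Q r₁) h₁
    (measurable_lmomentWeight P Q r₂) h₂, limitCov, Matrix.of_apply,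
    ← integral_prod _ (integrable_limitCovIntegrand P Q hlam hkernel r₁ r₂), ← integral_const_mul]
  refine integral_congr_ae (.of_forall fun p => ?_)
  simp only [limitCovIntegrand, lmomentWeight, legendreL, one_div, ← inv_pow]
  ring

variable [IsProbabilityMeasure μ]

theorem memLp_two_lmomentScore (hlam : lam ∈ Set.Ioo (0 : ℝ) 1) {ℓ : ℕ}
    (hsqrt : Integrable (fun y : ℝ => √(cdf P y * (1 - cdf P y)))) (r : Finset.Icc 2 ℓ) :
    MemLp (fun x => lmomentScore lam P Q ℓ x r) 2 P :=
  let ⟨_, h⟩ := exists_abs_lmomentWeight_le P Q hlam r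
  memLp_two_weightedScore P hsqrt (measurable_lmomentWeight P Q r) h

/-- Asymptotic normality of the empirical means of the scores. -/
theorem tendstoInDistribution_lmomentScore (hlaw : ∀ i, HasLaw (X i) P μ)
    (hindep : iIndepFun X μ) (hlam : lam ∈ Set.Ioo (0 : ℝ) 1) {ℓ : ℕ}
    (hsqrt : Integrable (fun y : ℝ => √(cdf P y * (1 - cdf P y))))
    (hkernel : Integrable (fun p : ℝ × ℝ => bridgeKernel (cdf P) p.1 p.2)) :
    TendstoInDistribution
      (fun (n : ℕ) ω => (√(n : ℝ))⁻¹ • ∑ k ∈ Finset.range n, lmomentScore lam P Q ℓ (X k ω))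
      atTop id (fun _ => μ)
      (multivariateGaussian 0 (limitCov ℓ lam (cdf P) (residualCdf lam (cdf P) (cdf Q)))) := by
  have hm := measurable_lmomentScore (lam := lam) P Q ℓ
  have hmr : ∀ r, Measurable fun x => lmomentScore lam P Q ℓ x r := fun r =>
    measurable_weightedScore P (measurable_lmomentWeight P Q r)
  refine tendstoInDistribution_inv_sqrt_smul_sum (Y := fun k ω => lmomentScore lam P Q ℓ (X k ω))
    (hindep.comp _ fun _ => hm)
    (fun k => (⟨(hlaw k).aemeasurable, (hlaw 0).aemeasurable,
      (hlaw k).map_eq.trans (hlaw 0).map_eq.symm⟩ : IdentDistrib (X k) (X 0) μ μ).comp hm)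
    (fun r => ?_) (fun r => ?_) fun r₁ r₂ => ?_
  · exact MemLp.comp_of_map (g := fun x => lmomentScore lam P Q ℓ x r) (f := X 0)
      ((hlaw 0).map_eq.symm ▸ memLp_two_lmomentScore P Q hlam hsqrt r) (hlaw 0).aemeasurable
  · obtain ⟨_, h⟩ := exists_abs_lmomentWeight_le P Q hlam r
    exact ((hlaw 0).integral_comp (hmr r).aestronglyMeasurable).trans
      (integral_weightedScore P hsqrt (measurable_lmomentWeight P Q r) h)
  · rw [limitCov_apply_eq_integral P Q hlam hsqrt hkernel]
    exact ((hlaw 0).integral_comp ((hmr r₁).mul (hmr r₂)).aestronglyMeasurable).symm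

/-- If a sequence of random vectors is coordinatewise bounded by `C √n ∫ (F_n - F)²`, it tends to
zero in probability. -/
theorem tendstoInMeasure_zero_of_le_integral_sq {ι : Type*} [Fintype ι]
    (hlaw : ∀ i, HasLaw (X i) P μ) (hindep : iIndepFun X μ)
    (hsqrt : Integrable (fun y : ℝ => √(cdf P y * (1 - cdf P y))))
    {R : ℕ → Ω → EuclideanSpace ℝ ι} (hR : ∀ n, AEMeasurable (R n) μ) (C : ι → ℝ)
    (hle : ∀ n : ℕ, 1 ≤ n → ∀ ω i,
      |R n ω i| ≤ √(n : ℝ) * (C i * ∫ y, empiricalDeviation X P n ω y ^ 2)) :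
    TendstoInMeasure μ R atTop 0 := by
  refine tendstoInMeasure_of_tendsto_eLpNorm one_ne_zero (fun n => (hR n).aestronglyMeasurable)
    aestronglyMeasurable_zero ?_
  set V := ∫ y, cdf P y * (1 - cdf P y)
  -- The `L¹` norm of `R n` is at most `√n * (∑ C i) * (V / n)`.
  have hlim : Tendsto (fun n : ℕ => ENNReal.ofReal ((∑ i, C i) * V * (√(n : ℝ))⁻¹))
      atTop (𝓝 0) := by
    have : Tendsto (fun n : ℕ => (∑ i, C i) * V * (√(n : ℝ))⁻¹) atTop (𝓝 0) := by
      simpa using (tendsto_inv_atTop_zero.comp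
        (Real.tendsto_sqrt_atTop.comp tendsto_natCast_atTop_atTop)).const_mul ((∑ i, C i) * V)
    simpa using ENNReal.tendsto_ofReal this
  refine tendsto_of_tendsto_of_tendsto_of_le_of_le' tendsto_const_nhds hlim
    (.of_forall fun _ => zero_le) ?_
  filter_upwards [eventually_ge_atTop 1] with n hn
  have hbound : ∀ ω, ‖R n ω‖ ≤
      √(n : ℝ) * (∑ i, C i) * ∫ y, empiricalDeviation X P n ω y ^ 2 := fun ω => by
    have hsum : ‖R n ω‖ ≤ ∑ i, |R n ω i| := by
      classical
      conv_lhs => rw [← (EuclideanSpace.basisFun ι ℝ).sum_repr (R n ω)]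
      refine (norm_sum_le _ _).trans_eq (Finset.sum_congr rfl fun i _ => ?_)
      simp [norm_smul]
    refine (hsum.trans (Finset.sum_le_sum fun i _ => hle n hn ω i)).trans_eq ?_
    rw [← Finset.mul_sum, ← Finset.sum_mul, mul_assoc]
  have hint := (integrable_uncurry_sq_empiricalDeviation hlaw hindep hsqrt n).integral_prod_left
  rw [sub_zero, eLpNorm_one_eq_lintegral_enorm]
  calc ∫⁻ ω, ‖R n ω‖ₑ ∂μ
      ≤ ∫⁻ ω, ENNReal.ofReal
          (√(n : ℝ) * (∑ i, C i) * ∫ y, empiricalDeviation X P n ω y ^ 2) ∂μ :=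
        lintegral_mono fun ω => by
          rw [← ofReal_norm]
          exact ENNReal.ofReal_le_ofReal (hbound ω)
    _ = ENNReal.ofReal (∫ ω, √(n : ℝ) * (∑ i, C i) *
          (∫ y, empiricalDeviation X P n ω y ^ 2) ∂μ) :=
        (ofReal_integral_eq_lintegral_ofReal (hint.const_mul _)
          -- No sign is assumed on `C`: the bound is nonnegative because it dominates a norm.
          (.of_forall fun ω => (norm_nonneg _).trans (hbound ω))).symm
    _ ≤ _ := by
        rw [integral_const_mul, integral_integral_sq_empiricalDeviation hlaw hindep hsqrt]
        refine ENNReal.ofReal_le_ofReal (le_of_eq ?_)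
        have hn0 : 0 < √(n : ℝ) := Real.sqrt_pos.2 (by positivity)
        have hnn : (n : ℝ)⁻¹ = (√(n : ℝ))⁻¹ * (√(n : ℝ))⁻¹ := by
          rw [← mul_inv, Real.mul_self_sqrt (Nat.cast_nonneg n)]
        rw [hnn]
        field_simp
        rfl

/-- Asymptotic normality of the L-moments of the residual of the empirical distribution. -/
theorem tendstoInDistribution_integral_lmomentK (hlaw : ∀ i, HasLaw (X i) P μ)
    (hindep : iIndepFun X μ) (hlam : lam ∈ Set.Ioo (0 : ℝ) 1) {ℓ : ℕ}
    (hsqrt : Integrable (fun y : ℝ => √(cdf P y * (1 - cdf P y))))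
    (hkernel : Integrable (fun p : ℝ × ℝ => bridgeKernel (cdf P) p.1 p.2))
    (hK : ∀ r ∈ Finset.Icc 2 ℓ,
      Integrable fun y => lmomentK r (residualCdf lam (cdf P) (cdf Q) y)) :
    TendstoInDistribution
      (fun (n : ℕ) (ω : Ω) => WithLp.toLp 2 fun r : Finset.Icc 2 ℓ =>
        √(n : ℝ) *
          ((∫ y, lmomentK r (residualCdf lam (empiricalCdf X n ω) (cdf Q) y)) -
            ∫ y, lmomentK r (residualCdf lam (cdf P) (cdf Q) y)))
      atTop id (fun _ => μ)
      (multivariateGaussian 0 (limitCov ℓ lam (cdf P) (residualCdf lam (cdf P) (cdf Q)))) := by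
  have hclt := tendstoInDistribution_lmomentScore P Q hlaw hindep hlam (ℓ := ℓ) hsqrt hkernel
  have hY : ∀ n : ℕ, AEMeasurable (fun ω => WithLp.toLp 2 fun r : Finset.Icc 2 ℓ =>
      √(n : ℝ) * ((∫ y, lmomentK r (residualCdf lam (empiricalCdf X n ω) (cdf Q) y)) -
        ∫ y, lmomentK r (residualCdf lam (cdf P) (cdf Q) y))) μ := fun n =>
    (WithLp.measurable_toLp 2 _).comp_aemeasurable (aemeasurable_pi_lambda _ fun r =>
      ((aemeasurable_integral_lmomentK Q (fun i => (hlaw i).aemeasurable) r n).sub_const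
        _).const_mul _)
  choose C hC using fun r : Finset.Icc 2 ℓ =>
    exists_abs_integral_lmomentK_sub_le X P Q hlam hsqrt r (hK r r.2)
  -- Slutsky: the statistic and the normalized sum of scores differ by a term tending to zero in
  -- probability.
  refine tendstoInDistribution_of_tendstoInMeasure_sub _ _ hclt
    (tendstoInMeasure_zero_of_le_integral_sq P hlaw hindep hsqrt
      (fun n => (hY n).sub (hclt.forall_aemeasurable n)) C fun n hn ω r => ?_) hY
  have hn0 : 0 < √(n : ℝ) := Real.sqrt_pos.2 (by positivity)
  have hinv : (√(n : ℝ))⁻¹ = √(n : ℝ) * (n : ℝ)⁻¹ := by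
    rw [← div_eq_mul_inv, Real.sqrt_div_self', one_div]
  refine le_of_eq_of_le ?_ (mul_le_mul_of_nonneg_left (hC r n hn ω).2 hn0.le)
  conv_rhs => rw [← abs_of_pos hn0, ← abs_mul]
  simp only [Pi.sub_apply, PiLp.sub_apply, PiLp.smul_apply, WithLp.ofLp_sum, Finset.sum_apply,
    lmomentScore, smul_eq_mul, hinv]
  ring_nf

end LimitTheorem

theorem mainTheorem4
    {Ω : Type*} [MeasurableSpace Ω] (μ : Measure Ω) [IsProbabilityMeasure μ]
    (PT : Measure ℝ) [IsProbabilityMeasure PT]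
    (X : ℕ → Ω → ℝ) (hlaw : ∀ i, HasLaw (X i) PT μ) (hindep : iIndepFun X μ)
    {d s : ℕ} (Θ : Set (EuclideanSpace ℝ (Fin d))) (A : Set (EuclideanSpace ℝ (Fin s)))
    (P₁ : Θ → Measure ℝ) [∀ θ, IsProbabilityMeasure (P₁ θ)]
    (Φ : Set (Set.Ioo (0 : ℝ) 1 × Θ × A)) (ℓ : ℕ)
    (hmean : ∀ i, Integrable (X i) μ)
    (hsqrt : Integrable (fun y : ℝ => √(cdf PT y * (1 - cdf PT y))))
    (hkernel : Integrable (fun p : ℝ × ℝ => bridgeKernel (cdf PT) p.1 p.2))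
    (φ : Set.Ioo (0 : ℝ) 1 × Θ × A) (hφ : φ ∈ Φ)
    (hK : ∀ r ∈ Finset.Icc 2 ℓ,
      Integrable (fun y : ℝ => lmomentK r (residualCdf φ.1 (cdf PT) (cdf (P₁ φ.2.1)) y))) :
    (∀ n : ℕ, 1 ≤ n → ∀ ω, ∀ r ∈ Finset.Icc 2 ℓ,
      Integrable (fun y : ℝ =>
        lmomentK r (residualCdf φ.1 (empiricalCdf X n ω) (cdf (P₁ φ.2.1)) y))) ∧
    (∀ r₁ ∈ Finset.Icc 2 ℓ, ∀ r₂ ∈ Finset.Icc 2 ℓ,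
      Integrable (fun p : ℝ × ℝ => limitCovIntegrand (cdf PT)
        (residualCdf φ.1 (cdf PT) (cdf (P₁ φ.2.1))) r₁ r₂ p.1 p.2)) ∧
    (limitCov ℓ φ.1 (cdf PT) (residualCdf φ.1 (cdf PT) (cdf (P₁ φ.2.1)))).PosSemidef ∧
    TendstoInDistribution
      (fun (n : ℕ) (ω : Ω) => WithLp.toLp 2 fun r : Finset.Icc 2 ℓ =>
        √(n : ℝ) *
          ((∫ y, lmomentK r (residualCdf φ.1 (empiricalCdf X n ω) (cdf (P₁ φ.2.1)) y)) -
            ∫ y, lmomentK r (residualCdf φ.1 (cdf PT) (cdf (P₁ φ.2.1)) y)))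
      atTop id (fun _ => μ)
      (multivariateGaussian 0
        (limitCov ℓ φ.1 (cdf PT) (residualCdf φ.1 (cdf PT) (cdf (P₁ φ.2.1))))) := by
  have hlam := φ.1.2
  refine ⟨fun n hn ω r hr => ?_, fun r₁ _ r₂ _ =>
    integrable_limitCovIntegrand PT (P₁ φ.2.1) hlam hkernel r₁ r₂,
    Matrix.posSemidef_of_eq_integral_mul (memLp_two_lmomentScore PT (P₁ φ.2.1) hlam hsqrt)
      (limitCov_apply_eq_integral PT (P₁ φ.2.1) hlam hsqrt hkernel),
    tendstoInDistribution_integral_lmomentK PT (P₁ φ.2.1) hlaw hindep hlam hsqrt hkernel hK⟩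
  obtain ⟨_, h⟩ :=
    exists_abs_integral_lmomentK_sub_le X PT (P₁ φ.2.1) hlam hsqrt r (hK r hr)
  exact (h n hn ω).1
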